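/- Let $n$ be a natural number, let $\mathbb F$ be a field and let $A$ be an $n\times n$ matrix over $\mathbb F$. For $S,T\subseteq[n]=\{1,\dots,n\}$, let $A[S,T]$ be the submatrix of $A$ with rows indexed by $S$ and columns indexed by $T$, let $A[S]=A[S,S]$, and let $\overline S$ be the complement of $S$ in the index set. We use the following notions. * Two square matrices $M,N$ over $\mathbb F$ with the same index set are *principal minor equivalent* (PME) if $\det M[S]=\det N[S]$ for every nonempty subset $S$ of the index set. * A set $X$ of indices of an $m\times m$ matrix $M$ is a *cut* of $M$ if $2\le |X|\le m-2$ and both $M[X,\overline X]$ and $M[\overline X,X]$ have rank at most $1$. * $A$ has *property $\mathcal R$* if all its off-diagonal entries are nonzero and, for any four distinct $i,j,k,\ell\in[n]$ with $\operatorname{rank}A[\{i,j\},\{k,\ell\}]=1$, there is $X\subseteq[n]$ with $i,j\in X$, $k,\ell\in\overline X$ and $\operatorname{rank}A[X,\overline X]=1$. * A set $S\subseteq[n]$ with $2\le|S|\le n-2$ is *plausible* for $A$ if for all two-element sets $\{i,j\}\subseteq S$ and $\{k,\ell\}\subseteq\overline S$ there is a $4\times4$ matrix over $\mathbb F$, indexed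 by $\{i,j,k,\ell\}$, that is PME to $A[\{i,j,k,\ell\}]$ and has $\{i,j\}$ as a cut. **Lemma.** Suppose that $A$ has property $\mathcal R$. Then a set $S\subseteq[n]$ is plausible for $A$ if and only if $S$ is a cut of some $n\times n$ matrix $C$ over $\mathbb F$ that is PME to $A$. -/

import Mathlib

/-- The submatrix `A[S, T]` with rows indexed by `S` and columns indexed by `T`. -/
def block {V F : Type*} (A : Matrix V V F) (S T : Finset V) : Matrix S T F :=
  A.submatrix (fun s : S => (s : V)) (fun t : T => (t : V))

/-- The principal submatrix `A[S] = A[S, S]`. -/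
def principal {V F : Type*} (A : Matrix V V F) (S : Finset V) : Matrix S S F :=
  block A S S

/-- Principal minor equivalence: all corresponding principal minors are equal (for `S = ∅` the
equation reads `1 = 1`). -/
def PME {V F : Type*} [DecidableEq V] [Field F] (A B : Matrix V V F) : Prop :=
  ∀ S : Finset V, (principal A S).det = (principal B S).det

/-- All off-diagonal entries are nonzero. -/
def IsDense {V F : Type*} [Field F] (A : Matrix V V F) : Prop :=
  ∀ i j : V, i ≠ j → A i j ≠ 0

/-- The rank-one extension property. -/
def RankOneExtension {V F : Type*} [Fintype V] [DecidableEq V] [Field F]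
    (A : Matrix V V F) : Prop :=
  ∀ i j k l : V, [i, j, k, l].Nodup → (block A {i, j} {k, l}).rank = 1 →
    ∃ X : Finset V, i ∈ X ∧ j ∈ X ∧ k ∈ Xᶜ ∧ l ∈ Xᶜ ∧ (block A X Xᶜ).rank = 1

/-- Property `R`: dense, with the rank-one extension property. -/
def PropertyR {V F : Type*} [Fintype V] [DecidableEq V] [Field F] (A : Matrix V V F) : Prop :=
  IsDense A ∧ RankOneExtension A

/-- `X` is a cut of `A`: `2 ≤ |X| ≤ n - 2` (so that `n ≥ 4`), and both `A[X, Xᶜ]` and `A[Xᶜ, X]`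
have rank at most one. -/
def IsCut {V F : Type*} [Fintype V] [DecidableEq V] [Field F]
    (A : Matrix V V F) (X : Finset V) : Prop :=
  2 ≤ X.card ∧ X.card + 2 ≤ Fintype.card V ∧
    (block A X Xᶜ).rank ≤ 1 ∧ (block A Xᶜ X).rank ≤ 1

/-- For distinct `i, j, k, l`, the pair of pairs `{{i, j}, {k, l}}` satisfies property `P`: some
matrix `C` indexed by `{i, j, k, l}` is principal minor equivalent to `A[{i, j, k, l}]` and has
`{i, j}`, seen as a set of indices of `C`, as a cut. -/
def PropertyP {V F : Type*} [DecidableEq V] [Field F]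
    (A : Matrix V V F) (i j k l : V) : Prop :=
  ∃ C : Matrix ({i, j, k, l} : Finset V) ({i, j, k, l} : Finset V) F,
    PME C (principal A {i, j, k, l}) ∧
      IsCut C (({i, j} : Finset V).subtype (fun v => v ∈ ({i, j, k, l} : Finset V)))

/-- `S` is a plausible set for `A`: `2 ≤ |S| ≤ n - 2`, and for all two-element sets
`{i, j} ⊆ S` and `{k, l} ⊆ Sᶜ`, the pair `{{i, j}, {k, l}}` satisfies property `P`. -/
def IsPlausible {V F : Type*} [Fintype V] [DecidableEq V] [Field F]
    (A : Matrix V V F) (S : Finset V) : Prop :=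
  2 ≤ S.card ∧ S.card + 2 ≤ Fintype.card V ∧
    ∀ i ∈ S, ∀ j ∈ S, ∀ k ∈ Sᶜ, ∀ l ∈ Sᶜ, i ≠ j → k ≠ l → PropertyP A i j k l

/-!
Fix `i ∈ S` and `k ∉ S`. There is only one candidate for `C` that agrees with `A` on `S ∪ {k}` and
on `Sᶜ ∪ {i}`: `cutMatrix A S i k`, whose entries across `S` are forced by the rank condition. That
it has the principal minors of `A` rests on two facts. On a quadruple `{i, j}, {k, l}` across `S`,
the cycle sums of a matrix with cut `{i, j}` are constrained, and for a dense `A` plausibility then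
forces the pairing `{i, j}, {k, l}` of `A` to be split, or both other pairings to be. Moreover, the
principal minors of a matrix split by `K` are determined by those inside `K` and inside its
complement, each enlarged by one index of the other.

By these two facts, the principal minors of `cutMatrix A S i k` do not depend on `i` and `k`. Hence
the minor indexed by `T` may be compared, by induction on `T`, under the assumption `i, k ∈ T`. If
`A` and the cut matrix differ at a pair of indices of `T`, take the component of this pair in the
graph of all such pairs: it splits both matrices and contains neither `i` nor `k`, so it cuts the
problem for `T` into two problems for proper subsets of `T`.
-/

section Determinants

open Matrix Polynomial

variable {m n R : Type*} [Fintype m] [Fintype n] [DecidableEq m] [DecidableEq n] [CommRing R]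

lemma det_mul_dotProduct_inv_mulVec {A : Matrix m m R} (hA : IsUnit A.det) (z u : m → R) :
    A.det * (z ⬝ᵥ A⁻¹ *ᵥ u) = z ⬝ᵥ A.adjugate *ᵥ u := by
  rw [inv_def, smul_mulVec, dotProduct_smul, smul_eq_mul, ← mul_assoc,
    Ring.mul_inverse_cancel _ hA, one_mul]

lemma det_add_vecMulVec_of_isUnit {B : Matrix n n R} (hB : IsUnit B.det) (w v : n → R) :
    (B + vecMulVec w v).det = B.det + v ⬝ᵥ B.adjugate *ᵥ w := by
  rw [vecMulVec_eq Unit, det_add_replicateCol_mul_replicateRow hB,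
    ← det_mul_dotProduct_inv_mulVec hB, det_unique (n := Unit), Matrix.mul_assoc,
    ← replicateCol_mulVec, Matrix.add_apply, replicateRow_mul_replicateCol_apply, one_apply_eq,
    mul_add, mul_one]

lemma det_fromBlocks_vecMulVec_of_isUnit {A : Matrix m m R} {B : Matrix n n R}
    (hA : IsUnit A.det) (hB : IsUnit B.det) (u z : m → R) (v w : n → R) :
    (fromBlocks A (vecMulVec u v) (vecMulVec w z) B).det =
      A.det * B.det - (z ⬝ᵥ A.adjugate *ᵥ u) * (v ⬝ᵥ B.adjugate *ᵥ w) := by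
  have := A.invertibleOfIsUnitDet hA
  have schur : B - vecMulVec w z * ⅟A * vecMulVec u v =
      B + vecMulVec (-(z ⬝ᵥ A⁻¹ *ᵥ u) • w) v := by
    rw [invOf_eq_nonsing_inv, vecMulVec_mul, vecMulVec_mul_vecMulVec, ← dotProduct_mulVec,
      neg_smul, neg_vecMulVec, vecMulVec_smul, smul_vecMulVec, sub_eq_add_neg]
  rw [det_fromBlocks₁₁, schur, det_add_vecMulVec_of_isUnit hB, mulVec_smul, dotProduct_smul,
    smul_eq_mul, ← det_mul_dotProduct_inv_mulVec hA]
  ring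

lemma map_dotProduct_adjugate_mulVec {R' : Type*} [CommRing R'] (φ : R →+* R')
    (A : Matrix m m R) (z u : m → R) :
    φ (z ⬝ᵥ A.adjugate *ᵥ u) = (φ ∘ z) ⬝ᵥ (A.map φ).adjugate *ᵥ (φ ∘ u) := by
  rw [RingHom.map_dotProduct, ← φ.mapMatrix_apply, ← φ.map_adjugate]
  congr 1
  ext x
  exact φ.map_mulVec _ _ _

lemma map_det_fromBlocks_vecMulVec {R' : Type*} [CommRing R'] (φ : R →+* R')
    (A : Matrix m m R) (B : Matrix n n R) (u z : m → R) (v w : n → R) :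
    φ (fromBlocks A (vecMulVec u v) (vecMulVec w z) B).det =
      (fromBlocks (A.map φ) (vecMulVec (φ ∘ u) (φ ∘ v)) (vecMulVec (φ ∘ w) (φ ∘ z))
        (B.map φ)).det := by
  rw [φ.map_det, φ.mapMatrix_apply, fromBlocks_map]
  congr 2 <;> ext <;> simp [vecMulVec_apply]

lemma det_fromBlocks_vecMulVec_of_mem_nonZeroDivisors {A : Matrix m m R} {B : Matrix n n R}
    (hA : A.det ∈ nonZeroDivisors R) (hB : B.det ∈ nonZeroDivisors R)
    (u z : m → R) (v w : n → R) :
    (fromBlocks A (vecMulVec u v) (vecMulVec w z) B).det =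
      A.det * B.det - (z ⬝ᵥ A.adjugate *ᵥ u) * (v ⬝ᵥ B.adjugate *ᵥ w) := by
  set φ := algebraMap R (FractionRing R)
  have hφA : IsUnit (A.map φ).det := by
    rw [← φ.mapMatrix_apply, ← φ.map_det]
    exact IsLocalization.map_units (FractionRing R) ⟨_, hA⟩
  have hφB : IsUnit (B.map φ).det := by
    rw [← φ.mapMatrix_apply, ← φ.map_det]
    exact IsLocalization.map_units (FractionRing R) ⟨_, hB⟩
  apply IsFractionRing.injective R (FractionRing R)
  rw [map_det_fromBlocks_vecMulVec, det_fromBlocks_vecMulVec_of_isUnit hφA hφB, map_sub, map_mul,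
    map_mul, map_dotProduct_adjugate_mulVec, map_dotProduct_adjugate_mulVec, φ.map_det, φ.map_det,
    φ.mapMatrix_apply, φ.mapMatrix_apply]

lemma det_X_add_map_C_mem_nonZeroDivisors (A : Matrix m m R) :
    ((X : R[X]) • (1 : Matrix m m R[X]) + A.map C).det ∈ nonZeroDivisors R[X] :=
  Monic.mem_nonZeroDivisors (leadingCoeff_det_X_one_add_C A)

lemma map_eval_zero_X_add_map_C {ι : Type*} [DecidableEq ι] (A : Matrix ι ι R) :
    ((X : R[X]) • (1 : Matrix ι ι R[X]) + A.map C).map (eval 0) = A := by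
  ext a b
  simp

theorem det_fromBlocks_vecMulVec (A : Matrix m m R) (B : Matrix n n R) (u z : m → R)
    (v w : n → R) :
    (fromBlocks A (vecMulVec u v) (vecMulVec w z) B).det =
      A.det * B.det - (z ⬝ᵥ A.adjugate *ᵥ u) * (v ⬝ᵥ B.adjugate *ᵥ w) := by
  have h := congrArg (evalRingHom (0 : R)) <| det_fromBlocks_vecMulVec_of_mem_nonZeroDivisors
    (det_X_add_map_C_mem_nonZeroDivisors A) (det_X_add_map_C_mem_nonZeroDivisors B)
    (C ∘ u) (C ∘ z) (C ∘ v) (C ∘ w)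
  rw [map_det_fromBlocks_vecMulVec] at h
  simpa only [map_sub, map_mul, map_dotProduct_adjugate_mulVec, RingHom.map_det,
    RingHom.mapMatrix_apply, coe_evalRingHom, map_eval_zero_X_add_map_C, Function.comp_def,
    eval_C] using h

end Determinants

open Matrix

section PrincipalMinors

variable {V R : Type*}

lemma principal_eq_principal_iff {M N : Matrix V V R} {S : Finset V} :
    principal M S = principal N S ↔ ∀ x ∈ S, ∀ y ∈ S, M x y = N x y := by
  simp only [← Matrix.ext_iff, Subtype.forall]
  rfl

variable [DecidableEq V]

lemma principal_insert_eq {M N : Matrix V V R} {i : V} {S : Finset V}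
    (hi : M i i = N i i) (hiS : ∀ x ∈ S, M i x = N i x ∧ M x i = N x i)
    (hS : ∀ x ∈ S, ∀ y ∈ S, M x y = N x y) :
    principal M (insert i S) = principal N (insert i S) := by
  simp only [principal_eq_principal_iff, Finset.forall_mem_insert]
  exact ⟨⟨hi, fun x hx => (hiS x hx).1⟩, fun x hx => ⟨(hiS x hx).2, hS x hx⟩⟩

variable [CommRing R]

lemma det_principal_of_range {ι : Type*} [Fintype ι] [DecidableEq ι] (M : Matrix V V R)
    {f : ι → V} (hf : f.Injective) {S : Finset V} (hS : Set.range f = S) :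
    (principal M S).det = (M.submatrix f f).det :=
  (det_submatrix_equiv_self ((Equiv.ofInjective f hf).trans (Equiv.setCongr hS))
    (principal M S)).symm

lemma det_principal_image {n : ℕ} (M : Matrix V V R) {f : Fin n → V} (hf : (List.ofFn f).Nodup) :
    (principal M (Finset.univ.image f)).det = (M.submatrix f f).det :=
  det_principal_of_range M (List.nodup_ofFn.mp hf) (by simp)

/-- The product of the entries of `M` along the cycle `(x y)`. -/
def twoCycle (M : Matrix V V R) (x y : V) : R :=
  M x y * M y x

/-- The sum of the products of the entries of `M` along the two cyclic permutations of
`x, y, z`. -/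
def threeCycles (M : Matrix V V R) (x y z : V) : R :=
  M x y * M y z * M z x + M y x * M z y * M x z

/-- The sum of the products of the entries of `M` along the six cyclic permutations of
`w, x, y, z`. -/
def fourCycles (M : Matrix V V R) (w x y z : V) : R :=
  M w x * M x y * M y z * M z w + M x w * M y x * M z y * M w z +
    (M w x * M x z * M z y * M y w + M x w * M z x * M y z * M w y) +
    (M w y * M y x * M x z * M z w + M y w * M x y * M z x * M w z)

lemma det_principal_singleton (M : Matrix V V R) (x : V) : (principal M {x}).det = M x x :=
  det_unique _

lemma det_principal_pair (M : Matrix V V R) {x y : V} (h : x ≠ y) :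
    (principal M {x, y}).det = M x x * M y y - twoCycle M x y := by
  have := det_principal_image M (f := ![x, y]) (by simpa using h)
  rw [show Finset.univ.image ![x, y] = {x, y} by ext; simp [eq_comm]] at this
  exact this.trans (det_fin_two _)

lemma det_principal_triple (M : Matrix V V R) {x y z : V} (h : [x, y, z].Nodup) :
    (principal M {x, y, z}).det = M x x * M y y * M z z - M x x * twoCycle M y z -
      M y y * twoCycle M x z - M z z * twoCycle M x y + threeCycles M x y z := by
  have := det_principal_image M (f := ![x, y, z]) h
  rw [show Finset.univ.image ![x, y, z] = {x, y, z} by ext; simp [eq_comm, Fin.exists_fin_succ],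
    det_fin_three] at this
  simp only [this, submatrix_apply, cons_val, twoCycle, threeCycles]
  ring

lemma det_principal_quadruple (M : Matrix V V R) {w x y z : V} (h : [w, x, y, z].Nodup) :
    (principal M {w, x, y, z}).det = M w w * (principal M {x, y, z}).det -
      M x x * M y y * twoCycle M w z - M x x * M z z * twoCycle M w y -
      M y y * M z z * twoCycle M w x + M x x * threeCycles M w y z +
      M y y * threeCycles M w x z + M z z * threeCycles M w x y +
      twoCycle M w x * twoCycle M y z + twoCycle M w y * twoCycle M x z +
      twoCycle M w z * twoCycle M x y - fourCycles M w x y z := by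
  have := det_principal_image M (f := ![w, x, y, z]) h
  rw [show Finset.univ.image ![w, x, y, z] = {w, x, y, z} by
    ext; simp [eq_comm, Fin.exists_fin_succ], det_succ_row_zero] at this
  simp only [this, det_principal_triple M (List.nodup_cons.mp h).2, Fin.sum_univ_four,
    det_fin_three, submatrix_apply, Fin.succAbove, Fin.reduceCastSucc, Fin.reduceSucc,
    Fin.reduceLT, ↓reduceIte, Fin.coe_ofNat_eq_mod, cons_val, twoCycle, threeCycles, fourCycles]
  ring

end PrincipalMinors

section PMEOn

variable {V R : Type*} [DecidableEq V] [CommRing R] {M N L : Matrix V V R} {S T : Finset V}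

/-- `M` and `N` have the same principal minors inside `S`: the restriction of principal minor
equivalence to the subsets of `S`, which is what inductions on the index set need. -/
def PMEOn (M N : Matrix V V R) (S : Finset V) : Prop :=
  ∀ T ⊆ S, (principal M T).det = (principal N T).det

namespace PMEOn

lemma of_principal_eq (h : principal M S = principal N S) : PMEOn M N S := fun _ hT =>
  congrArg det <| principal_eq_principal_iff.mpr fun x hx y hy =>
    principal_eq_principal_iff.mp h x (hT hx) y (hT hy)

lemma symm (h : PMEOn M N S) : PMEOn N M S := fun T hT => (h T hT).symm

lemma trans (h : PMEOn M N S) (h' : PMEOn N L S) : PMEOn M L S :=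
  fun T hT => (h T hT).trans (h' T hT)

lemma mono (h : PMEOn M N S) (hT : T ⊆ S) : PMEOn M N T := fun U hU => h U (hU.trans hT)

lemma of_erase (hS : (principal M S).det = (principal N S).det)
    (h : ∀ x ∈ S, PMEOn M N (S.erase x)) : PMEOn M N S := by
  intro T hT
  rcases hT.eq_or_ssubset with rfl | hT
  · exact hS
  · obtain ⟨x, hx, hTx⟩ := Finset.ssubset_iff_exists_subset_erase.mp hT
    exact h x hx T hTx

lemma apply_self (h : PMEOn M N S) {x : V} (hx : x ∈ S) : M x x = N x x := by
  simpa only [det_principal_singleton] using h {x} (by simpa using hx)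

lemma twoCycle_eq (h : PMEOn M N S) {x y : V} (hx : x ∈ S) (hy : y ∈ S) :
    twoCycle M x y = twoCycle N x y := by
  rcases eq_or_ne x y with rfl | hxy
  · simp only [twoCycle, h.apply_self hx]
  · have hpair := h {x, y} (by grind)
    rw [det_principal_pair M hxy, det_principal_pair N hxy, h.apply_self hx, h.apply_self hy]
      at hpair
    linear_combination -hpair

lemma threeCycles_eq (h : PMEOn M N S) {x y z : V} (hxyz : [x, y, z].Nodup)
    (hS : {x, y, z} ⊆ S) : threeCycles M x y z = threeCycles N x y z := by
  have hx : x ∈ S := hS (by simp)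
  have hy : y ∈ S := hS (by simp)
  have hz : z ∈ S := hS (by simp)
  have htriple := h _ hS
  rw [det_principal_triple M hxyz, det_principal_triple N hxyz, h.apply_self hx, h.apply_self hy,
    h.apply_self hz, h.twoCycle_eq hy hz, h.twoCycle_eq hx hz, h.twoCycle_eq hx hy] at htriple
  linear_combination htriple

lemma fourCycles_eq (h : PMEOn M N S) {w x y z : V} (hwxyz : [w, x, y, z].Nodup)
    (hS : {w, x, y, z} ⊆ S) : fourCycles M w x y z = fourCycles N w x y z := by
  have hw : w ∈ S := hS (by simp)
  have hx : x ∈ S := hS (by simp)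
  have hy : y ∈ S := hS (by simp)
  have hz : z ∈ S := hS (by simp)
  have hwxy := h.threeCycles_eq (x := w) (y := x) (z := y) (by grind) (by grind)
  have hwxz := h.threeCycles_eq (x := w) (y := x) (z := z) (by grind) (by grind)
  have hwyz := h.threeCycles_eq (x := w) (y := y) (z := z) (by grind) (by grind)
  have hquadruple := h _ hS
  rw [det_principal_quadruple M hwxyz, det_principal_quadruple N hwxyz, h {x, y, z} (by grind),
    h.apply_self hw, h.apply_self hx, h.apply_self hy, h.apply_self hz, h.twoCycle_eq hw hx,
    h.twoCycle_eq hw hy, h.twoCycle_eq hw hz, h.twoCycle_eq hx hy, h.twoCycle_eq hx hz,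
    h.twoCycle_eq hy hz, hwxy, hwxz, hwyz] at hquadruple
  linear_combination -hquadruple

end PMEOn

end PMEOn

section Splits

variable {V R : Type*} [CommRing R] {M N : Matrix V V R} {i j k l : V}

/-- The blocks `M[{i, j}, {k, l}]` and `M[{k, l}, {i, j}]` are singular. -/
def PairSplit (M : Matrix V V R) (i j k l : V) : Prop :=
  M i k * M j l = M i l * M j k ∧ M k i * M l j = M k j * M l i

namespace PairSplit

lemma symm (h : PairSplit M i j k l) : PairSplit M k l i j := ⟨h.2, h.1⟩

lemma swap_left (h : PairSplit M i j k l) : PairSplit M j i k l := by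
  constructor
  · linear_combination -h.1
  · linear_combination -h.2

lemma swap_right (h : PairSplit M i j k l) : PairSplit M i j l k := h.symm.swap_left.symm

lemma refl_left (M : Matrix V V R) (i k l : V) : PairSplit M i i k l :=
  ⟨mul_comm _ _, rfl⟩

lemma refl_right (M : Matrix V V R) (i j k : V) : PairSplit M i j k k := (refl_left M k i j).symm

lemma trans [NoZeroDivisors R] {m : V} (h : PairSplit M i j k l) (h' : PairSplit M j m k l)
    (hjk : M j k ≠ 0) (hkj : M k j ≠ 0) : PairSplit M i m k l := by
  constructor
  · apply mul_left_cancel₀ hjk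
    linear_combination M m k * h.1 + M i k * h'.1
  · apply mul_left_cancel₀ hkj
    linear_combination M k m * h.2 + M k i * h'.2

end PairSplit

/-- `K` and `L` are split by `M`: the `2 × 2` minors of the blocks `M[K, L]` and `M[L, K]`
vanish. This is the rank condition in the definition of a cut, without its cardinality condition
and for two sets that need not cover the index set. -/
def IsSplit (M : Matrix V V R) (K L : Finset V) : Prop :=
  ∀ i ∈ K, ∀ j ∈ K, ∀ k ∈ L, ∀ l ∈ L, PairSplit M i j k l

namespace IsSplit

variable {K L : Finset V}

lemma of_eq_mul {u v w z : V → R} (h : ∀ x ∈ K, ∀ y ∈ L, M x y = u x * v y ∧ M y x = w y * z x) :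
    IsSplit M K L := by
  intro i hi j hj k hk l hl
  rw [PairSplit, (h i hi k hk).1, (h i hi l hl).1, (h j hj k hk).1, (h j hj l hl).1,
    (h i hi k hk).2, (h i hi l hl).2, (h j hj k hk).2, (h j hj l hl).2]
  exact ⟨by ring, by ring⟩

lemma congr (h : IsSplit M K L) (hN : ∀ x ∈ K, ∀ y ∈ L, N x y = M x y ∧ N y x = M y x) :
    IsSplit N K L := by
  intro i hi j hj k hk l hl
  rw [PairSplit, (hN i hi k hk).1, (hN i hi l hl).1, (hN j hj k hk).1, (hN j hj l hl).1,
    (hN i hi k hk).2, (hN i hi l hl).2, (hN j hj k hk).2, (hN j hj l hl).2]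
  exact h i hi j hj k hk l hl

lemma mono {K' L' : Finset V} (h : IsSplit M K L) (hK : K' ⊆ K) (hL : L' ⊆ L) : IsSplit M K' L' :=
  fun i hi j hj k hk l hl => h i (hK hi) j (hK hj) k (hL hk) l (hL hl)

end IsSplit

end Splits

section CutFormula

variable {V R : Type*} [DecidableEq V] [CommRing R] {M : Matrix V V R} {S T : Finset V}

/-- The bilinear form `(z, u) ↦ zᵀ adj(M[S]) u`, which expresses the determinant of `M[S]`
bordered by the row `z` and the column `u`. -/
def adjugateForm (M : Matrix V V R) (S : Finset V) (z u : V → R) : R :=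
  (fun x : S => z x) ⬝ᵥ (principal M S).adjugate *ᵥ fun x : S => u x

lemma adjugateForm_smul_smul (M : Matrix V V R) (S : Finset V) (a b : R) (z u : V → R) :
    adjugateForm M S (a • z) (b • u) = a * b * adjugateForm M S z u := by
  change (a • fun x : S => z x) ⬝ᵥ (principal M S).adjugate *ᵥ (b • fun x : S => u x) = _
  rw [mulVec_smul, dotProduct_smul, smul_dotProduct, smul_eq_mul, smul_eq_mul, adjugateForm]
  ring

lemma adjugateForm_singleton (M : Matrix V V R) (q : V) (z u : V → R) :
    adjugateForm M {q} z u = z q * u q := by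
  rw [adjugateForm, adjugate_subsingleton, one_mulVec, dotProduct]
  exact Fintype.sum_unique _

lemma det_principal_union_of_eq_mul (hST : Disjoint S T) {u v w z : V → R}
    (h : ∀ x ∈ S, ∀ y ∈ T, M x y = u x * v y ∧ M y x = w y * z x) :
    (principal M (S ∪ T)).det = (principal M S).det * (principal M T).det -
      adjugateForm M S z u * adjugateForm M T v w := by
  have hinj : (Sum.elim (fun x : S => (x : V)) fun y : T => (y : V)).Injective :=
    Subtype.val_injective.sumElim Subtype.val_injective fun x y =>
      Finset.disjoint_iff_ne.mp hST x x.2 y y.2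
  rw [det_principal_of_range M hinj (by ext; simp), adjugateForm, adjugateForm,
    ← det_fromBlocks_vecMulVec]
  congr 1
  ext (x | x) (y | y)
  · rfl
  · exact (h x x.2 y y.2).1
  · exact (h y y.2 x x.2).2
  · rfl

lemma det_principal_insert (M : Matrix V V R) {q : V} (hq : q ∉ S) :
    (principal M (insert q S)).det = M q q * (principal M S).det -
      adjugateForm M S (fun x => M q x) fun x => M x q := by
  have := det_principal_union_of_eq_mul (M := M) (Finset.disjoint_singleton_right.mpr hq)
    (u := fun x => M x q) (v := 1) (w := 1) (z := fun x => M q x) (by simp)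
  rw [Finset.insert_eq, Finset.union_comm, this, adjugateForm_singleton, det_principal_singleton]
  simp only [Pi.one_apply]
  ring

end CutFormula

section PrincipalMinorsOfSplits

variable {V F : Type*} [DecidableEq V] [Field F] {M N : Matrix V V F} {K L S T : Finset V}

lemma IsSplit.det_principal_union (h : IsSplit M K L) (hKL : Disjoint K L) {p q : V} (hp : p ∈ K)
    (hq : q ∈ L) (hpq : M p q ≠ 0) (hqp : M q p ≠ 0) (hS : S ⊆ K) (hT : T ⊆ L) :
    M p q * M q p * ((principal M (S ∪ T)).det - (principal M S).det * (principal M T).det) =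
      -((M q q * (principal M S).det - (principal M (insert q S)).det) *
        (M p p * (principal M T).det - (principal M (insert p T)).det)) := by
  have hqS : q ∉ S := fun hqS => Finset.disjoint_left.mp hKL (hS hqS) hq
  have hpT : p ∉ T := fun hpT => Finset.disjoint_left.mp hKL hp (hT hpT)
  have factor : ∀ x ∈ S, ∀ y ∈ T,
      M x y = M x q * ((M p q)⁻¹ • M p) y ∧ M y x = ((M q p)⁻¹ • fun y => M y p) y * M q x := by
    intro x hx y hy
    obtain ⟨h₁, h₂⟩ := h x (hS hx) p hp q hq y (hT hy)
    simp only [Pi.smul_apply, smul_eq_mul]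
    constructor <;> field_simp
    · linear_combination -h₁
    · linear_combination -h₂
  rw [det_principal_union_of_eq_mul (Finset.disjoint_of_subset_left hS
    (Finset.disjoint_of_subset_right hT hKL)) factor, adjugateForm_smul_smul,
    det_principal_insert M hqS, det_principal_insert M hpT]
  field_simp
  ring

lemma PMEOn.union_of_isSplit (hM : IsSplit M K L) (hN : IsSplit N K L) (hKL : Disjoint K L)
    {p q : V} (hp : p ∈ K) (hq : q ∈ L) (hpq : M p q ≠ 0) (hqp : M q p ≠ 0)
    (hK : PMEOn M N (insert q K)) (hL : PMEOn M N (insert p L)) : PMEOn M N (K ∪ L) := by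
  intro T hT
  have hTKL : T = T ∩ K ∪ T ∩ L := by
    rw [← Finset.inter_union_distrib_left, Finset.inter_eq_left.mpr hT]
  have hTK : T ∩ K ⊆ K := Finset.inter_subset_right
  have hTL : T ∩ L ⊆ L := Finset.inter_subset_right
  have hcycle : M p q * M q p = N p q * N q p :=
    hK.twoCycle_eq (Finset.mem_insert_of_mem hp) (Finset.mem_insert_self q K)
  have hN₀ : N p q * N q p ≠ 0 := hcycle ▸ mul_ne_zero hpq hqp
  have formula_M := hM.det_principal_union hKL hp hq hpq hqp hTK hTL
  have formula_N := hN.det_principal_union hKL hp hq (left_ne_zero_of_mul hN₀)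
    (right_ne_zero_of_mul hN₀) hTK hTL
  rw [hK _ (hTK.trans (Finset.subset_insert q K)), hL _ (hTL.trans (Finset.subset_insert p L)),
    hK _ (Finset.insert_subset_insert q hTK), hL _ (Finset.insert_subset_insert p hTL),
    hK.apply_self (Finset.mem_insert_self q K), hL.apply_self (Finset.mem_insert_self p L),
    hcycle, ← formula_N] at formula_M
  rw [hTKL]
  linear_combination mul_left_cancel₀ hN₀ formula_M

/-- The matrix `D * M * D⁻¹` with `D = diagonal d`, entrywise. -/
def diagSimilar (d : V → F) (M : Matrix V V F) : Matrix V V F :=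
  of fun x y => d x * M x y / d y

lemma pmeOn_diagSimilar {d : V → F} (hd : ∀ x, d x ≠ 0) (M : Matrix V V F) (S : Finset V) :
    PMEOn (diagSimilar d M) M S := by
  intro T _
  have hprincipal : principal (diagSimilar d M) T =
      of fun x y : T => (d y)⁻¹ * (of fun x y : T => d x * principal M T x y) x y := by
    ext x y
    exact div_eq_inv_mul _ _
  rw [hprincipal, det_mul_row, det_mul_column, ← mul_assoc, ← Finset.prod_mul_distrib,
    Finset.prod_congr rfl fun (x : T) _ => inv_mul_cancel₀ (hd x), Finset.prod_const_one, one_mul]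

end PrincipalMinorsOfSplits

section QuartetDichotomy

variable {V R : Type*} [CommRing R] {M : Matrix V V R} {i j k l : V}

namespace PairSplit

lemma twoCycle_mul_twoCycle (h : PairSplit M i j k l) :
    twoCycle M j k * twoCycle M i l = twoCycle M j l * twoCycle M i k := by
  unfold twoCycle
  linear_combination -M k j * M l i * h.1 - M i k * M j l * h.2

lemma threeCycles_mul_twoCycle (h : PairSplit M i j k l) :
    threeCycles M i j k * twoCycle M i l = threeCycles M i j l * twoCycle M i k := by
  unfold threeCycles twoCycle
  linear_combination -M i j * M k i * M l i * h.1 - M j i * M i k * M i l * h.2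

lemma twoCycle_mul_fourCycles (h : PairSplit M i j k l) :
    twoCycle M i k * (fourCycles M i j k l - twoCycle M i k * twoCycle M j l -
      twoCycle M i l * twoCycle M j k) = threeCycles M i j k * threeCycles M i k l := by
  unfold fourCycles threeCycles twoCycle
  linear_combination (M i j * M l k * M k i ^ 2 -
    M i k * M k i * (M k i * M l j - M k j * M l i)) * h.1 + M j i * M k l * M i k ^ 2 * h.2

end PairSplit

/-- Both other pairings of `i, j, k, l` are pair splits. -/
def CrossSplit (M : Matrix V V R) (i j k l : V) : Prop :=
  PairSplit M i k j l ∧ PairSplit M i l j k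

end QuartetDichotomy

section QuartetDichotomyOfDense

variable {V F : Type*} [Field F] {M : Matrix V V F} {i j k l : V}

/- By the two hypotheses, the two summands of `threeCycles M i j k * twoCycle M i l` and those of
`threeCycles M i j l * twoCycle M i k` have the same sum and the same product, so they are the same
up to order. -/
lemma pairSplit_or_of_cycles (hM : IsDense M) (hijkl : [i, j, k, l].Nodup)
    (htwo : twoCycle M j k * twoCycle M i l = twoCycle M j l * twoCycle M i k)
    (hthree : threeCycles M i j k * twoCycle M i l = threeCycles M i j l * twoCycle M i k) :
    PairSplit M i j k l ∨
      M i j * M j k * M l i = M j i * M l j * M i k ∧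
        M i j * M j l * M k i = M j i * M k j * M i l := by
  have hij : M i j ≠ 0 := hM i j (by grind)
  have hji : M j i ≠ 0 := hM j i (by grind)
  have hik : M i k ≠ 0 := hM i k (by grind)
  have hki : M k i ≠ 0 := hM k i (by grind)
  have hil : M i l ≠ 0 := hM i l (by grind)
  have hli : M l i ≠ 0 := hM l i (by grind)
  unfold twoCycle at htwo
  unfold threeCycles twoCycle at hthree
  have roots : (M i j * M j k * M k i * (M i l * M l i) -
      M i j * M j l * M l i * (M i k * M k i)) *
      (M i j * M j k * M k i * (M i l * M l i) -
        M j i * M l j * M i l * (M i k * M k i)) = 0 := by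
    linear_combination M i j * M j k * M k i * (M i l * M l i) * hthree -
      M i j * M j i * M i k * M k i * M i l * M l i * htwo
  rcases mul_eq_zero.mp roots with h | h
  · left
    constructor
    · apply mul_left_cancel₀ (mul_ne_zero (mul_ne_zero hij hki) hli)
      linear_combination -h
    · apply mul_left_cancel₀ (mul_ne_zero (mul_ne_zero hji hik) hil)
      linear_combination h - hthree
  · right
    constructor
    · apply mul_left_cancel₀ (mul_ne_zero hki hil)
      linear_combination h
    · apply mul_left_cancel₀ (mul_ne_zero hik hli)
      linear_combination h - hthree

lemma pairSplit_or_crossSplit (hM : IsDense M) (hijkl : [i, j, k, l].Nodup)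
    (htwo : twoCycle M j k * twoCycle M i l = twoCycle M j l * twoCycle M i k)
    (hthree : threeCycles M i j k * twoCycle M i l = threeCycles M i j l * twoCycle M i k)
    (hthree' : threeCycles M k l i * twoCycle M k j = threeCycles M k l j * twoCycle M k i)
    (hfour : twoCycle M i k * (fourCycles M i j k l - twoCycle M i k * twoCycle M j l -
      twoCycle M i l * twoCycle M j k) = threeCycles M i j k * threeCycles M i k l) :
    PairSplit M i j k l ∨ CrossSplit M i j k l := by
  rw [or_iff_not_imp_left]
  intro hsplit
  obtain ⟨h₁, h₂⟩ := (pairSplit_or_of_cycles hM hijkl htwo hthree).resolve_left hsplit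
  obtain ⟨h₃, h₄⟩ := (pairSplit_or_of_cycles (i := k) (j := l) (k := i) (l := j) hM (by grind)
    (by unfold twoCycle at htwo ⊢; linear_combination htwo) hthree').resolve_left
    fun h => hsplit h.symm
  have hij : M i j ≠ 0 := hM i j (by grind)
  have hki : M k i ≠ 0 := hM k i (by grind)
  have hil : M i l ≠ 0 := hM i l (by grind)
  have hlk : M l k ≠ 0 := hM l k (by grind)
  have hjk : M j k ≠ 0 := hM j k (by grind)
  set D := M i k * M j l - M i l * M j k with hD
  set E := M k i * M l j - M k j * M l i with hE
  have hDE : M i l * M j k * E = -(M k i * M l j * D) := by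
    unfold twoCycle at htwo
    linear_combination (M i l * M j k) * hE + M k i * M l j * hD - htwo
  have hD₀ : D ≠ 0 := by
    intro hD₀
    rw [hD₀, mul_zero, neg_zero] at hDE
    exact hsplit ⟨sub_eq_zero.mp hD₀,
      sub_eq_zero.mp ((mul_eq_zero.mp hDE).resolve_left (mul_ne_zero hil hjk))⟩
  have key : M i j * M l k = M i k * M l j := by
    unfold fourCycles threeCycles twoCycle at hfour
    have hfour' : M i j * M l k * M k i ^ 2 * D + M j i * M k l * M i k ^ 2 * E =
        M i k * M k i * D * E := by
      linear_combination hfour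
    apply mul_left_cancel₀ (mul_ne_zero (pow_ne_zero 2 hki) (pow_ne_zero 2 hD₀))
    linear_combination -M i l * M j k * hfour' +
      (M j i * M k l * M i k ^ 2 - M i k * M k i * D) * hDE + M k i ^ 2 * D * M i j * M l k * hD +
      M k i * D * M i k * (M k l * h₁ - M i j * h₃)
  have key' : M i j * M k l = M i l * M k j := by
    apply mul_left_cancel₀ hlk
    linear_combination M k l * key + h₄
  refine ⟨⟨key', ?_⟩, key, ?_⟩
  · apply mul_left_cancel₀ hij
    linear_combination M j i * key - h₁
  · apply mul_left_cancel₀ hij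
    linear_combination M j i * key' - h₂

end QuartetDichotomyOfDense

section CutsAndPlausibility

variable {V F : Type*} [DecidableEq V] [Field F] {A M C : Matrix V V F} {S : Finset V}
  {i j k l : V}

lemma PairSplit.pairSplit_or_crossSplit_of_pmeOn (hC : PairSplit C i j k l) (hCM : PMEOn C M S)
    (hM : IsDense M) (hijkl : [i, j, k, l].Nodup) (hS : {i, j, k, l} ⊆ S) :
    PairSplit M i j k l ∨ CrossSplit M i j k l := by
  have htwo : ∀ x ∈ [i, j, k, l], ∀ y ∈ [i, j, k, l], twoCycle C x y = twoCycle M x y :=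
    fun x hx y hy => hCM.twoCycle_eq (by grind) (by grind)
  have hthree : ∀ x ∈ [i, j, k, l], ∀ y ∈ [i, j, k, l], ∀ z ∈ [i, j, k, l], [x, y, z].Nodup →
      threeCycles C x y z = threeCycles M x y z :=
    fun x hx y hy z hz hxyz => hCM.threeCycles_eq hxyz (by grind)
  apply pairSplit_or_crossSplit hM hijkl
  · have h := hC.twoCycle_mul_twoCycle
    grind
  · have h := hC.threeCycles_mul_twoCycle
    grind
  · have h := hC.symm.threeCycles_mul_twoCycle
    grind
  · have h := hC.twoCycle_mul_fourCycles
    have hfour := hCM.fourCycles_eq hijkl hS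
    grind

lemma mul_apply_eq_of_rank_le_one {m n : Type*} [Fintype n] {B : Matrix m n F} (hB : B.rank ≤ 1)
    (x y : m) (z w : n) : B x z * B y w = B x w * B y z := by
  have hdet : (B.submatrix ![x, y] ![z, w]).det = 0 := by
    by_contra hne
    have hrank := rank_of_isUnit _ ((isUnit_iff_isUnit_det _).mpr (isUnit_iff_ne_zero.mpr hne))
    have := (rank_submatrix_le B ![x, y] ![z, w]).trans hB
    rw [hrank, Fintype.card_fin] at this
    omega
  rw [det_fin_two] at hdet
  exact sub_eq_zero.mp hdet

lemma IsCut.isSplit [Fintype V] (h : IsCut C S) : IsSplit C S Sᶜ :=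
  fun i hi j hj k hk l hl =>
    ⟨mul_apply_eq_of_rank_le_one h.2.2.1 ⟨i, hi⟩ ⟨j, hj⟩ ⟨k, hk⟩ ⟨l, hl⟩,
      mul_apply_eq_of_rank_le_one h.2.2.2 ⟨k, hk⟩ ⟨l, hl⟩ ⟨i, hi⟩ ⟨j, hj⟩⟩

lemma PropertyP.pairSplit_or_crossSplit (hA : IsDense A) (hijkl : [i, j, k, l].Nodup)
    (h : PropertyP A i j k l) : PairSplit A i j k l ∨ CrossSplit A i j k l := by
  obtain ⟨C, hCA, hcut⟩ := h
  let i' : ({i, j, k, l} : Finset V) := ⟨i, by simp⟩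
  let j' : ({i, j, k, l} : Finset V) := ⟨j, by simp⟩
  let k' : ({i, j, k, l} : Finset V) := ⟨k, by simp⟩
  let l' : ({i, j, k, l} : Finset V) := ⟨l, by simp⟩
  have hsplit : PairSplit C i' j' k' l' := hcut.isSplit i' (by simp [i']) j' (by simp [j']) k'
    (by simp [k']; grind) l' (by simp [l']; grind)
  exact hsplit.pairSplit_or_crossSplit_of_pmeOn (M := principal A _) (S := Finset.univ)
    (fun T _ => hCA T) (fun x y hxy => hA x y (Subtype.val_injective.ne hxy))
    (List.Nodup.of_map Subtype.val hijkl) (Finset.subset_univ _)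

/-- Every quadruple with two indices in `S` and two outside has the three-way split structure that
property `P` imposes on a dense matrix: the pairing along `S` splits, or both other pairings do. -/
def QuartetDichotomy (A : Matrix V V F) (S : Finset V) : Prop :=
  ∀ i ∈ S, ∀ j ∈ S, ∀ k ∉ S, ∀ l ∉ S, i ≠ j → k ≠ l → PairSplit A i j k l ∨ CrossSplit A i j k l

lemma QuartetDichotomy.compl [Fintype V] (h : QuartetDichotomy A S) : QuartetDichotomy A Sᶜ := by
  intro i hi j hj k hk l hl hij hkl
  rw [Finset.mem_compl] at hi hj
  rw [Finset.mem_compl, not_not] at hk hl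
  rcases h k hk l hl i hi j hj hkl hij with h | h
  · exact .inl h.symm
  · exact .inr ⟨h.1.swap_left.swap_right, h.2.symm.swap_left.swap_right⟩

lemma IsPlausible.quartetDichotomy [Fintype V] (hA : IsDense A) (h : IsPlausible A S) :
    QuartetDichotomy A S := fun i hi j hj k hk l hl hij hkl =>
  (h.2.2 i hi j hj k (Finset.mem_compl.mpr hk) l (Finset.mem_compl.mpr hl) hij
    hkl).pairSplit_or_crossSplit hA (by grind)

end CutsAndPlausibility

section PathFactorization

variable {V F : Type*} [Field F] {A M N : Matrix V V F} {i j k l : V} {P Q S : Finset V} {α β : F}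

/-- The entries of `M` between `P` and `Q` are constant multiples, by `α` from `P` to `Q` and by `β`
from `Q` to `P`, of the products along the paths of length two through `i`. -/
def FactorsThrough (M : Matrix V V F) (i : V) (P Q : Finset V) (α β : F) : Prop :=
  ∀ k ∈ P, ∀ l ∈ Q, M k l = α * (M k i * M i l) ∧ M l k = β * (M l i * M i k)

namespace FactorsThrough

lemma symm (h : FactorsThrough M i P Q α β) : FactorsThrough M i Q P β α :=
  fun l hl k hk => (h k hk l hl).symm

lemma mono_left {P' : Finset V} (h : FactorsThrough M i P Q α β) (hP : P' ⊆ P) :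
    FactorsThrough M i P' Q α β := fun k hk => h k (hP hk)

lemma isSplit [DecidableEq V] (h : FactorsThrough M i P Q α β) : IsSplit M P (insert i Q) := by
  refine .of_eq_mul (u := fun x => M x i) (v := fun y => if y = i then 1 else α * M i y)
    (w := fun y => if y = i then 1 else β * M y i) (z := fun x => M i x) fun x hx y hy => ?_
  by_cases hyi : y = i
  · simp [hyi]
  · obtain ⟨h₁, h₂⟩ := h x hx y ((Finset.mem_insert.mp hy).resolve_left hyi)
    rw [if_neg hyi, if_neg hyi, h₁, h₂]
    exact ⟨by ring, by ring⟩

end FactorsThrough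

lemma IsDense.ne_zero_of_mem_of_notMem (hA : IsDense A) {x y : V} (hx : x ∈ S) (hy : y ∉ S) :
    A x y ≠ 0 :=
  hA x y (ne_of_mem_of_not_mem hx hy)

lemma IsDense.ne_zero_of_notMem_of_mem (hA : IsDense A) {x y : V} (hx : x ∉ S) (hy : y ∈ S) :
    A x y ≠ 0 :=
  hA x y (ne_of_mem_of_not_mem hy hx).symm

/-- The entry of `M` at `(x, y)` relative to the product along the path from `x` to `y` through
`i`. -/
def pathRatio (M : Matrix V V F) (x i y : V) : F :=
  M x y / (M x i * M i y)

lemma IsDense.pathRatio_ne_zero (hA : IsDense A) {x y : V} (hxi : x ≠ i) (hiy : i ≠ y)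
    (hxy : x ≠ y) : pathRatio A x i y ≠ 0 :=
  div_ne_zero (hA x y hxy) (mul_ne_zero (hA x i hxi) (hA i y hiy))

lemma FactorsThrough.of_crossSplit (hA : IsDense A) (hij : i ≠ j) (hki : k ≠ i)
    (hP : ∀ m ∈ P, PairSplit A i j k m)
    (hPQ : ∀ m ∈ P, ∀ l ∈ Q, CrossSplit A i j m l) :
    FactorsThrough A i P Q (pathRatio A k i j) (pathRatio A j i k) := by
  intro m hm l hl
  have nij := hA i j hij
  have nji := hA j i hij.symm
  have nki := hA k i hki
  have nik := hA i k hki.symm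
  obtain ⟨h₁, h₂⟩ := hP m hm
  obtain ⟨⟨h₃, h₄⟩, -, -⟩ := hPQ m hm l hl
  unfold pathRatio
  constructor
  · field_simp
    linear_combination A k i * h₃ + A i l * h₂
  · field_simp
    linear_combination A i k * h₄ + A l i * h₁

lemma QuartetDichotomy.crossSplit_of_not_pairSplit (h : QuartetDichotomy A S) (hi : i ∈ S)
    (hj : j ∈ S) (hk : k ∉ S) (hl : l ∉ S) (hs : ¬PairSplit A i j k l) : CrossSplit A i j k l := by
  refine (h i hi j hj k hk l hl ?_ ?_).resolve_left hs
  · rintro rfl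
    exact hs (.refl_left A i k l)
  · rintro rfl
    exact hs (.refl_right A i j k)

variable [DecidableEq V]

lemma PMEOn.insert_union_of_factorsThrough {γ δ : F} (hM : FactorsThrough M i P Q α β)
    (hN : FactorsThrough N i P Q γ δ) (hPQ : Disjoint P Q) (hiP : i ∉ P)
    (hM₀ : ∀ k ∈ P, M k i ≠ 0 ∧ M i k ≠ 0) (hP : PMEOn M N (insert i P))
    (hQ : PMEOn M N (insert i Q)) (hk : ∀ k ∈ P, PMEOn M N (insert i (insert k Q))) :
    PMEOn M N (insert i (P ∪ Q)) := by
  rcases P.eq_empty_or_nonempty with rfl | ⟨k, hkP⟩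
  · rwa [Finset.empty_union]
  · rw [← Finset.union_insert]
    exact .union_of_isSplit hM.isSplit hN.isSplit (Finset.disjoint_insert_right.mpr ⟨hiP, hPQ⟩) hkP
      (Finset.mem_insert_self i Q) (hM₀ k hkP).1 (hM₀ k hkP).2 hP
      (by rw [Finset.insert_comm]; exact hk k hkP)

lemma PMEOn.triple_of_factorsThrough (hikl : [i, k, l].Nodup)
    (hM : FactorsThrough M i {k} {l} α β) (hN : FactorsThrough N i {k} {l} β α)
    (hk : PMEOn M N {i, k}) (hl : PMEOn M N {i, l}) : PMEOn M N {i, k, l} := by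
  obtain ⟨hMkl, hMlk⟩ := hM k (by simp) l (by simp)
  obtain ⟨hNkl, hNlk⟩ := hN k (by simp) l (by simp)
  have hik₂ : twoCycle M i k = twoCycle N i k := hk.twoCycle_eq (by simp) (by simp)
  have hil₂ : twoCycle M i l = twoCycle N i l := hl.twoCycle_eq (by simp) (by simp)
  have hkl₂ : twoCycle M k l = twoCycle N k l := by
    have hM₂ : twoCycle M k l = α * β * (twoCycle M i k * twoCycle M i l) := by
      rw [twoCycle, hMkl, hMlk, twoCycle, twoCycle]; ring
    have hN₂ : twoCycle N k l = α * β * (twoCycle N i k * twoCycle N i l) := by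
      rw [twoCycle, hNkl, hNlk, twoCycle, twoCycle]; ring
    rw [hM₂, hN₂, hik₂, hil₂]
  have hikl₃ : threeCycles M i k l = threeCycles N i k l := by
    have hM₃ : threeCycles M i k l = (α + β) * (twoCycle M i k * twoCycle M i l) := by
      rw [threeCycles, hMkl, hMlk, twoCycle, twoCycle]; ring
    have hN₃ : threeCycles N i k l = (α + β) * (twoCycle N i k * twoCycle N i l) := by
      rw [threeCycles, hNkl, hNlk, twoCycle, twoCycle]; ring
    rw [hM₃, hN₃, hik₂, hil₂]
  have hi₁ : M i i = N i i := hk.apply_self (by simp)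
  have hk₁ : M k k = N k k := hk.apply_self (by simp)
  have hl₁ : M l l = N l l := hl.apply_self (by simp)
  have hkl : PMEOn M N {k, l} := by
    apply PMEOn.of_erase
    · rw [det_principal_pair M (by grind), det_principal_pair N (by grind), hk₁, hl₁, hkl₂]
    · intro x hx
      rcases Finset.mem_insert.mp hx with rfl | hx
      · exact hl.mono (by grind)
      · exact hk.mono (by grind)
  apply PMEOn.of_erase
  · rw [det_principal_triple M hikl, det_principal_triple N hikl, hi₁, hk₁, hl₁, hik₂, hil₂, hkl₂,
      hikl₃]
  · intro x hx
    obtain rfl | rfl | rfl : x = i ∨ x = k ∨ x = l := by simpa using hx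
    · exact hkl.mono (by grind)
    · exact hl.mono (by grind)
    · exact hk.mono (by grind)

/- Principal minors do not see the exchange of `α` and `β`: both occur symmetrically in the cycles
through `i`. -/
lemma PMEOn.insert_union_of_factorsThrough_swap (hM : FactorsThrough M i P Q α β)
    (hN : FactorsThrough N i P Q β α) (hPQ : Disjoint P Q) (hiP : i ∉ P) (hiQ : i ∉ Q)
    (hM₀ : ∀ k ∈ P ∪ Q, M k i ≠ 0 ∧ M i k ≠ 0) (hP : PMEOn M N (insert i P))
    (hQ : PMEOn M N (insert i Q)) : PMEOn M N (insert i (P ∪ Q)) := by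
  refine .insert_union_of_factorsThrough hM hN hPQ hiP
    (fun k hk => hM₀ k (Finset.mem_union_left Q hk)) hP hQ fun k hk => ?_
  have hkP : {k} ⊆ P := Finset.singleton_subset_iff.mpr hk
  have hik : PMEOn M N {i, k} := hP.mono (Finset.insert_subset_insert i hkP)
  rw [Finset.insert_eq k, Finset.union_comm]
  refine .insert_union_of_factorsThrough (hM.mono_left hkP).symm (hN.mono_left hkP).symm
    (Finset.disjoint_of_subset_right hkP hPQ.symm) hiQ
    (fun l hl => hM₀ l (Finset.mem_union_right P hl)) hQ hik fun l hl => ?_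
  have hlQ : {l} ⊆ Q := Finset.singleton_subset_iff.mpr hl
  rw [show ({l, k} : Finset V) = {k, l} from Finset.pair_comm l k]
  have hikl : [i, k, l].Nodup := by
    have hkl : k ≠ l := Finset.disjoint_iff_ne.mp hPQ k hk l hl
    grind
  exact .triple_of_factorsThrough hikl ((hM.mono_left hkP).symm.mono_left hlQ).symm
    ((hN.mono_left hkP).symm.mono_left hlQ).symm hik
    (hQ.mono (Finset.insert_subset_insert i hlQ))

end PathFactorization

section CutMatrix

variable {V F : Type*} [DecidableEq V] [Field F] {A : Matrix V V F} {S T : Finset V}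
  {i j k l x y : V}

/-- For `i ∈ S` and `k ∉ S`, the matrix that agrees with `A` on `S ∪ {k}` and on `Sᶜ ∪ {i}` and is
split by `S`. -/
def cutMatrix (A : Matrix V V F) (S : Finset V) (i k : V) : Matrix V V F :=
  of fun x y => if x ∈ S then if y ∈ S then A x y else A x k * A i y / A i k
    else if y ∈ S then A k y * A x i / A k i else A x y

lemma cutMatrix_of_mem (hx : x ∈ S) (hy : y ∈ S) : cutMatrix A S i k x y = A x y := by
  simp [cutMatrix, hx, hy]

lemma cutMatrix_of_notMem (hx : x ∉ S) (hy : y ∉ S) : cutMatrix A S i k x y = A x y := by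
  simp [cutMatrix, hx, hy]

lemma cutMatrix_of_mem_of_notMem (hx : x ∈ S) (hy : y ∉ S) :
    cutMatrix A S i k x y = A x k * A i y / A i k := by
  simp [cutMatrix, hx, hy]

lemma cutMatrix_of_notMem_of_mem (hx : x ∉ S) (hy : y ∈ S) :
    cutMatrix A S i k x y = A k y * A x i / A k i := by
  simp [cutMatrix, hx, hy]

lemma cutMatrix_compl [Fintype V] (A : Matrix V V F) (S : Finset V) (i k : V) :
    cutMatrix A Sᶜ k i = cutMatrix A S i k := by
  ext x y
  by_cases hx : x ∈ S <;> by_cases hy : y ∈ S <;> simp [cutMatrix, hx, hy, mul_comm]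

lemma cutMatrix_of_pairSplit (hA : IsDense A) (hi : i ∈ S) (hk : k ∉ S) (hx : x ∈ S) (hy : y ∉ S)
    (h : PairSplit A i x k y) :
    cutMatrix A S i k x y = A x y ∧ cutMatrix A S i k y x = A y x := by
  rw [cutMatrix_of_mem_of_notMem hx hy, cutMatrix_of_notMem_of_mem hy hx,
    div_eq_iff (hA.ne_zero_of_mem_of_notMem hi hk), div_eq_iff (hA.ne_zero_of_notMem_of_mem hk hi)]
  exact ⟨by linear_combination -h.1, by linear_combination -h.2⟩

lemma principal_cutMatrix_insert_left (hA : IsDense A) (hi : i ∈ S) (hk : k ∉ S) :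
    principal (cutMatrix A S i k) (insert k S) = principal A (insert k S) := by
  refine principal_insert_eq (cutMatrix_of_notMem hk hk) (fun x hx => ?_) fun x hx y hy =>
    cutMatrix_of_mem hx hy
  exact (cutMatrix_of_pairSplit hA hi hk hx hk (.refl_right A i x k)).symm

lemma isSplit_cutMatrix [Fintype V] (A : Matrix V V F) (S : Finset V) (i k : V) :
    IsSplit (cutMatrix A S i k) S Sᶜ := by
  refine .of_eq_mul (u := fun x => A x k) (v := fun y => A i y / A i k)
    (w := fun y => A y i / A k i) (z := fun x => A k x) fun x hx y hy => ?_
  rw [Finset.mem_compl] at hy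
  rw [cutMatrix_of_mem_of_notMem hx hy, cutMatrix_of_notMem_of_mem hy hx]
  exact ⟨by ring, by ring⟩

lemma isCut_cutMatrix [Fintype V] (A : Matrix V V F) (i k : V) (hS : 2 ≤ S.card)
    (hS' : S.card + 2 ≤ Fintype.card V) : IsCut (cutMatrix A S i k) S := by
  have hblock : block (cutMatrix A S i k) S Sᶜ =
      vecMulVec (fun x : S => A x k) fun y : (Sᶜ : Finset V) => A i y / A i k := by
    ext x y
    exact (cutMatrix_of_mem_of_notMem x.2 (Finset.mem_compl.mp y.2)).trans (mul_div_assoc _ _ _)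
  have hblock' : block (cutMatrix A S i k) Sᶜ S =
      vecMulVec (fun y : (Sᶜ : Finset V) => A y i / A k i) fun x : S => A k x := by
    ext y x
    refine (cutMatrix_of_notMem_of_mem (Finset.mem_compl.mp y.2) x.2).trans ?_
    rw [mul_div_assoc, mul_comm, vecMulVec_apply]
  refine ⟨hS, hS', ?_, ?_⟩
  · rw [hblock]
    exact rank_vecMulVec_le _ _
  · rw [hblock']
    exact rank_vecMulVec_le _ _

lemma cutMatrix_of_crossSplit (hA : IsDense A) (hi : i ∈ S) (hj : j ∈ S) (hk : k ∉ S) (hl : l ∉ S)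
    (hij : i ≠ j) (h : CrossSplit A i j k l) :
    cutMatrix A S j k i l = pathRatio A k i j / pathRatio A j i k * A i l ∧
      cutMatrix A S j k l i = pathRatio A j i k / pathRatio A k i j * A l i := by
  have nij := hA i j hij
  have nji := hA j i hij.symm
  have nki := hA.ne_zero_of_notMem_of_mem hk hi
  have nik := hA.ne_zero_of_mem_of_notMem hi hk
  have nkj := hA.ne_zero_of_notMem_of_mem hk hj
  have njk := hA.ne_zero_of_mem_of_notMem hj hk
  obtain ⟨⟨h₁, h₂⟩, h₃, h₄⟩ := h
  rw [cutMatrix_of_mem_of_notMem hi hl, cutMatrix_of_notMem_of_mem hl hi]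
  unfold pathRatio
  constructor
  · field_simp
    linear_combination A j i * h₁ - A i j * h₄
  · field_simp
    linear_combination A i j * h₂ - A j i * h₃

lemma pmeOn_cutMatrix_insert_of_crossSplit (hA : IsDense A) (hi : i ∈ S) (hj : j ∈ S) (hk : k ∉ S)
    (hij : i ≠ j) (hT : ∀ l ∈ T, l ∉ S ∧ CrossSplit A i j k l) :
    PMEOn A (cutMatrix A S j k) (insert i T) := by
  have hik : i ≠ k := ne_of_mem_of_not_mem hi hk
  have hjk : j ≠ k := ne_of_mem_of_not_mem hj hk
  have hα : pathRatio A k i j ≠ 0 := hA.pathRatio_ne_zero hik.symm hij hjk.symm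
  have hβ : pathRatio A j i k ≠ 0 := hA.pathRatio_ne_zero hij.symm hik hjk
  set d : V → F := fun x => if x = i then 1 else pathRatio A j i k / pathRatio A k i j
  have hd : ∀ x, d x ≠ 0 := by
    intro x
    by_cases hx : x = i <;> simp [d, hx, hα, hβ]
  refine (pmeOn_diagSimilar hd A _).symm.trans (.of_principal_eq ?_)
  have hne : ∀ l ∈ T, l ≠ i := fun l hl => (ne_of_mem_of_not_mem hi (hT l hl).1).symm
  refine principal_insert_eq ?_ (fun l hl => ?_) fun x hx y hy => ?_
  · simp [diagSimilar, d, cutMatrix_of_mem hi hi]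
  · obtain ⟨hil, hli⟩ := cutMatrix_of_crossSplit hA hi hj hk (hT l hl).1 hij (hT l hl).2
    simp only [hil, hli, diagSimilar, d, of_apply, ↓reduceIte, if_neg (hne l hl)]
    constructor <;> field_simp
  · rw [cutMatrix_of_notMem (hT x hx).1 (hT y hy).1]
    simp only [diagSimilar, d, of_apply, if_neg (hne x hx), if_neg (hne y hy)]
    field_simp

lemma principal_cutMatrix_insert_of_pairSplit (hA : IsDense A) (hi : i ∈ S) (hj : j ∈ S)
    (hk : k ∉ S) (hT : ∀ l ∈ T, l ∉ S ∧ PairSplit A i j k l) :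
    principal A (insert i T) = principal (cutMatrix A S j k) (insert i T) := by
  refine principal_insert_eq (cutMatrix_of_mem hi hi).symm (fun l hl => ?_) fun x hx y hy =>
    (cutMatrix_of_notMem (hT x hx).1 (hT y hy).1).symm
  obtain ⟨hil, hli⟩ := cutMatrix_of_pairSplit hA hj hk hi (hT l hl).1 (hT l hl).2.swap_left
  exact ⟨hil.symm, hli.symm⟩

lemma pmeOn_cutMatrix_insert_union (hA : IsDense A) (hi : i ∈ S) (hj : j ∈ S) (hk : k ∉ S)
    (hij : i ≠ j) {P Q : Finset V} (hdisj : Disjoint P Q)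
    (hP : ∀ m ∈ P, m ∉ S ∧ PairSplit A i j k m) (hQ : ∀ l ∈ Q, l ∉ S ∧ CrossSplit A i j k l)
    (hPQ : ∀ m ∈ P, ∀ l ∈ Q, CrossSplit A i j m l) :
    PMEOn A (cutMatrix A S j k) (insert i (P ∪ Q)) := by
  have hik : i ≠ k := ne_of_mem_of_not_mem hi hk
  have hjk : j ≠ k := ne_of_mem_of_not_mem hj hk
  have hα : pathRatio A k i j ≠ 0 := hA.pathRatio_ne_zero hik.symm hij hjk.symm
  have hβ : pathRatio A j i k ≠ 0 := hA.pathRatio_ne_zero hij.symm hik hjk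
  have hfactors : FactorsThrough A i P Q (pathRatio A k i j) (pathRatio A j i k) :=
    .of_crossSplit hA hij hik.symm (fun m hm => (hP m hm).2) hPQ
  have hfactors' : FactorsThrough (cutMatrix A S j k) i P Q (pathRatio A j i k)
      (pathRatio A k i j) := by
    intro m hm l hl
    obtain ⟨hmS, hm'⟩ := hP m hm
    obtain ⟨hlS, hl'⟩ := hQ l hl
    obtain ⟨him, hmi⟩ := cutMatrix_of_pairSplit hA hj hk hi hmS hm'.swap_left
    obtain ⟨hil, hli⟩ := cutMatrix_of_crossSplit hA hi hj hk hlS hij hl'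
    rw [cutMatrix_of_notMem hmS hlS, cutMatrix_of_notMem hlS hmS, hil, hli, him, hmi,
      (hfactors m hm l hl).1, (hfactors m hm l hl).2]
    constructor <;> field_simp
  have hS : ∀ l ∈ P ∪ Q, l ∉ S := fun l hl =>
    (Finset.mem_union.mp hl).elim (fun hl => (hP l hl).1) fun hl => (hQ l hl).1
  exact .insert_union_of_factorsThrough_swap hfactors hfactors' hdisj
    (fun h => hS i (Finset.mem_union_left Q h) hi) (fun h => hS i (Finset.mem_union_right P h) hi)
    (fun l hl => ⟨hA.ne_zero_of_notMem_of_mem (hS l hl) hi,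
      hA.ne_zero_of_mem_of_notMem hi (hS l hl)⟩)
    (.of_principal_eq (principal_cutMatrix_insert_of_pairSplit hA hi hj hk hP))
    (pmeOn_cutMatrix_insert_of_crossSplit hA hi hj hk hij hQ)

open Classical in
lemma pmeOn_cutMatrix_insert (hA : IsDense A) (hS : QuartetDichotomy A S) (hi : i ∈ S) (hj : j ∈ S)
    (hk : k ∉ S) (hT : ∀ l ∈ T, l ∉ S) : PMEOn A (cutMatrix A S j k) (insert i T) := by
  rcases eq_or_ne i j with rfl | hij
  · exact .of_principal_eq <| principal_cutMatrix_insert_of_pairSplit hA hi hi hk fun l hl =>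
      ⟨hT l hl, .refl_left A i k l⟩
  rw [← Finset.filter_union_filter_not_eq (fun l => PairSplit A i j k l) T]
  refine pmeOn_cutMatrix_insert_union hA hi hj hk hij (Finset.disjoint_filter_filter_not _ _ _)
    (fun m hm => ?_) (fun l hl => ?_) fun m hm l hl => ?_
  · obtain ⟨hmT, hm'⟩ := Finset.mem_filter.mp hm
    exact ⟨hT m hmT, hm'⟩
  · obtain ⟨hlT, hl'⟩ := Finset.mem_filter.mp hl
    exact ⟨hT l hlT, hS.crossSplit_of_not_pairSplit hi hj hk (hT l hlT) hl'⟩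
  · obtain ⟨hmT, hm'⟩ := Finset.mem_filter.mp hm
    obtain ⟨hlT, hl'⟩ := Finset.mem_filter.mp hl
    refine hS.crossSplit_of_not_pairSplit hi hj (hT m hmT) (hT l hlT) fun h => hl' ?_
    exact (hm'.symm.trans h.symm (hA.ne_zero_of_notMem_of_mem (hT m hmT) hi)
      (hA.ne_zero_of_mem_of_notMem hi (hT m hmT))).symm

lemma pmeOn_cutMatrix_cutMatrix_left [Finite V] (hA : IsDense A) (hS : QuartetDichotomy A S)
    (hi : i ∈ S) (hj : j ∈ S) (hk : k ∉ S) (T : Finset V) :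
    PMEOn (cutMatrix A S i k) (cutMatrix A S j k) T := by
  cases nonempty_fintype V
  have hcompl : ∀ l ∈ Sᶜ, l ∉ S := fun l hl => Finset.mem_compl.mp hl
  obtain ⟨hik, hki⟩ := cutMatrix_of_pairSplit hA hi hk hi hk (.refl_left A i k k)
  refine PMEOn.mono (S := S ∪ Sᶜ) ?_ (by simp)
  refine .union_of_isSplit (isSplit_cutMatrix A S i k) (isSplit_cutMatrix A S j k)
    disjoint_compl_right hi (Finset.mem_compl.mpr hk) ?_ ?_ (.of_principal_eq ?_) ?_
  · rw [hik]
    exact hA.ne_zero_of_mem_of_notMem hi hk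
  · rw [hki]
    exact hA.ne_zero_of_notMem_of_mem hk hi
  · rw [principal_cutMatrix_insert_left hA hi hk, principal_cutMatrix_insert_left hA hj hk]
  · exact (pmeOn_cutMatrix_insert hA hS hi hi hk hcompl).symm.trans
      (pmeOn_cutMatrix_insert hA hS hi hj hk hcompl)

lemma pmeOn_cutMatrix_cutMatrix [Finite V] (hA : IsDense A) (hS : QuartetDichotomy A S)
    (hi : i ∈ S) (hj : j ∈ S) (hk : k ∉ S) (hl : l ∉ S) (T : Finset V) :
    PMEOn (cutMatrix A S i k) (cutMatrix A S j l) T := by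
  cases nonempty_fintype V
  refine (pmeOn_cutMatrix_cutMatrix_left hA hS hi hj hk T).trans ?_
  rw [← cutMatrix_compl A S j k, ← cutMatrix_compl A S j l]
  exact pmeOn_cutMatrix_cutMatrix_left hA hS.compl (Finset.mem_compl.mpr hk)
    (Finset.mem_compl.mpr hl) (by simpa using hj) T

end CutMatrix

section CrossGraph

lemma not_reachable_of_forall_not_adj {V : Type*} {G : SimpleGraph V} {x y : V} (hxy : x ≠ y)
    (hy : ∀ z, ¬G.Adj z y) : ¬G.Reachable x y := by
  rw [SimpleGraph.reachable_iff_reflTransGen]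
  intro h
  rcases Relation.ReflTransGen.cases_tail h with h | ⟨z, -, hzy⟩
  · exact hxy h.symm
  · exact hy z hzy

variable {V F : Type*} [Field F] {A : Matrix V V F} {S K : Finset V} {i k x y z : V}

/-- The pairs across `S` at which `A` differs from `cutMatrix A S i k`: the obstructions to `A`
being split by `S`. -/
def crossGraph (A : Matrix V V F) (S : Finset V) (i k : V) : SimpleGraph V :=
  .fromRel fun x y => x ∈ S ∧ y ∉ S ∧ ¬PairSplit A i x k y

lemma crossGraph_adj_iff (hx : x ∈ S) (hy : y ∉ S) :
    (crossGraph A S i k).Adj x y ↔ ¬PairSplit A i x k y := by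
  simp [crossGraph, hx, hy, ne_of_mem_of_not_mem hx hy]

lemma mem_iff_notMem_of_crossGraph_adj (h : (crossGraph A S i k).Adj x y) : x ∈ S ↔ y ∉ S := by
  rw [crossGraph, SimpleGraph.fromRel_adj] at h
  tauto

lemma not_crossGraph_adj_left (hi : i ∈ S) (y : V) : ¬(crossGraph A S i k).Adj y i := by
  intro h
  have hy : y ∉ S := (mem_iff_notMem_of_crossGraph_adj h.symm).mp hi
  exact (crossGraph_adj_iff hi hy).mp h.symm (.refl_left A i k y)

lemma not_crossGraph_adj_right (hk : k ∉ S) (x : V) : ¬(crossGraph A S i k).Adj x k := by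
  intro h
  have hx : x ∈ S := (mem_iff_notMem_of_crossGraph_adj h).mpr hk
  exact (crossGraph_adj_iff hx hk).mp h (.refl_right A i x k)

lemma QuartetDichotomy.pairSplit_of_crossGraph_adj (hA : IsDense A) (hS : QuartetDichotomy A S)
    (hi : i ∈ S) (hk : k ∉ S) (hxy : (crossGraph A S i k).Adj x y)
    (hxz : ¬(crossGraph A S i k).Adj x z) (hyz : ¬(crossGraph A S i k).Adj y z) :
    PairSplit A x y z k := by
  wlog hx : x ∈ S generalizing x y
  · have hy : y ∈ S := by
      by_contra hy
      exact hx ((mem_iff_notMem_of_crossGraph_adj hxy).mpr hy)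
    exact (this hxy.symm hyz hxz hy).swap_left
  have hy : y ∉ S := (mem_iff_notMem_of_crossGraph_adj hxy).mp hx
  have hixky : ¬PairSplit A i x k y := (crossGraph_adj_iff hx hy).mp hxy
  by_cases hz : z ∈ S
  · have hizky : PairSplit A i z k y := by
      by_contra h
      exact hyz ((crossGraph_adj_iff hz hy).mpr h).symm
    have hzxky : ¬PairSplit A z x k y := fun h => hixky <|
      hizky.trans h (hA.ne_zero_of_mem_of_notMem hz hk) (hA.ne_zero_of_notMem_of_mem hk hz)
    exact (hS.crossSplit_of_not_pairSplit hz hx hk hy hzxky).1.symm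
  · have hixkz : PairSplit A i x k z := by
      by_contra h
      exact hxz ((crossGraph_adj_iff hx hz).mpr h)
    have hixzy : ¬PairSplit A i x z y := fun h => hixky <|
      (hixkz.symm.trans h.symm (hA.ne_zero_of_notMem_of_mem hz hi)
        (hA.ne_zero_of_mem_of_notMem hi hz)).symm
    have hix : i ≠ x := by
      rintro rfl
      exact hixky (.refl_left A i k y)
    have hizxy : PairSplit A i z x y := (hS.crossSplit_of_not_pairSplit hi hx hz hy hixzy).1
    have hikxy : PairSplit A i k x y := (hS.crossSplit_of_not_pairSplit hi hx hk hy hixky).1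
    exact (hizxy.swap_left.trans hikxy (hA i x hix) (hA x i hix.symm)).symm

lemma QuartetDichotomy.pairSplit_of_reachable (hA : IsDense A) (hS : QuartetDichotomy A S)
    (hi : i ∈ S) (hk : k ∉ S) (hxy : (crossGraph A S i k).Reachable x y)
    (hxz : ¬(crossGraph A S i k).Reachable x z) : PairSplit A x y z k := by
  rw [SimpleGraph.reachable_iff_reflTransGen] at hxy
  induction hxy with
  | refl => exact .refl_left A x z k
  | @tail b c hxb hbc ih =>
    rw [← SimpleGraph.reachable_iff_reflTransGen] at hxb
    have hxc := hxb.trans hbc.reachable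
    have hbz : b ≠ z := fun h => hxz (h ▸ hxb)
    exact ih.trans (hS.pairSplit_of_crossGraph_adj hA hi hk hbc
      (fun h => hxz (hxb.trans h.reachable)) fun h => hxz (hxc.trans h.reachable))
      (hA b z hbz) (hA z b hbz.symm)

variable [DecidableEq V]

lemma QuartetDichotomy.isSplit_component [Fintype V] (hA : IsDense A) (hS : QuartetDichotomy A S)
    (hi : i ∈ S) (hk : k ∉ S) (hK : ∀ y, y ∈ K ↔ (crossGraph A S i k).Reachable x y)
    (hkK : k ∉ K) : IsSplit A K Kᶜ := by
  have hxK : x ∈ K := (hK x).mpr .rfl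
  have hpair : ∀ y ∈ K, ∀ z ∉ K, PairSplit A x y z k := fun y hy z hz =>
    hS.pairSplit_of_reachable hA hi hk ((hK y).mp hy) (mt (hK z).mpr hz)
  have hpair' : ∀ y ∈ K, ∀ y' ∈ K, ∀ z ∉ K, PairSplit A y y' z k := fun y hy y' hy' z hz =>
    (hpair y hy z hz).swap_left.trans (hpair y' hy' z hz)
      (hA.ne_zero_of_mem_of_notMem hxK hz) (hA.ne_zero_of_notMem_of_mem hz hxK)
  intro y hy y' hy' z hz z' hz'
  rw [Finset.mem_compl] at hz hz'
  exact ((hpair' y hy y' hy' z hz).symm.trans (hpair' y hy y' hy' z' hz').symm.swap_left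
    (hA.ne_zero_of_notMem_of_mem hkK hy) (hA.ne_zero_of_mem_of_notMem hy hkK)).symm

lemma cutMatrix_of_not_crossGraph_adj (hA : IsDense A) (hi : i ∈ S) (hk : k ∉ S)
    (h : ¬(crossGraph A S i k).Adj x y) :
    cutMatrix A S i k x y = A x y ∧ cutMatrix A S i k y x = A y x := by
  by_cases hx : x ∈ S <;> by_cases hy : y ∈ S
  · exact ⟨cutMatrix_of_mem hx hy, cutMatrix_of_mem hy hx⟩
  · rw [crossGraph_adj_iff hx hy, not_not] at h
    exact cutMatrix_of_pairSplit hA hi hk hx hy h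
  · rw [SimpleGraph.adj_comm, crossGraph_adj_iff hy hx, not_not] at h
    exact (cutMatrix_of_pairSplit hA hi hk hy hx h).symm
  · exact ⟨cutMatrix_of_notMem hx hy, cutMatrix_of_notMem hy hx⟩

end CrossGraph

section CutMatrixPME

variable {V F : Type*} [Finite V] [DecidableEq V] [Field F] {A : Matrix V V F} {S T : Finset V}
  {i k x y : V}

/- The component of the edge splits both matrices, and `T` is split by it into two parts, each of
which misses a vertex of `T` even after adding a vertex of the other. -/
open Classical in
lemma pmeOn_cutMatrix_of_crossGraph_adj (hA : IsDense A) (hS : QuartetDichotomy A S)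
    (hi : i ∈ S) (hk : k ∉ S) (hiT : i ∈ T) (hkT : k ∈ T) (hxT : x ∈ T) (hyT : y ∈ T)
    (hxy : (crossGraph A S i k).Adj x y) (hT : ∀ T' ⊂ T, PMEOn A (cutMatrix A S i k) T') :
    PMEOn A (cutMatrix A S i k) T := by
  cases nonempty_fintype V
  set K := Finset.univ.filter fun z => (crossGraph A S i k).Reachable x z
  have hK : ∀ z, z ∈ K ↔ (crossGraph A S i k).Reachable x z := by simp [K]
  have hxK : x ∈ K := (hK x).mpr .rfl
  have hyK : y ∈ K := (hK y).mpr hxy.reachable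
  have hxi : x ≠ i := by
    rintro rfl
    exact not_crossGraph_adj_left hi y hxy.symm
  have hxk : x ≠ k := by
    rintro rfl
    exact not_crossGraph_adj_right hk y hxy.symm
  have hiK : i ∉ K :=
    mt (hK i).mp (not_reachable_of_forall_not_adj hxi (not_crossGraph_adj_left hi))
  have hkK : k ∉ K :=
    mt (hK k).mp (not_reachable_of_forall_not_adj hxk (not_crossGraph_adj_right hk))
  have hA_split : IsSplit A K Kᶜ := hS.isSplit_component hA hi hk hK hkK
  have hcut_split : IsSplit (cutMatrix A S i k) K Kᶜ := hA_split.congr fun a ha b hb =>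
    cutMatrix_of_not_crossGraph_adj hA hi hk fun hab =>
      Finset.mem_compl.mp hb ((hK b).mpr (((hK a).mp ha).trans hab.reachable))
  have hik : i ≠ k := ne_of_mem_of_not_mem hi hk
  have hxy' : x ≠ y := hxy.ne
  have hTK : T ∩ K ⊆ K := Finset.inter_subset_right
  have hTK' : T \ K ⊆ Kᶜ := fun z hz => Finset.mem_compl.mpr (Finset.mem_sdiff.mp hz).2
  rw [← Finset.sdiff_union_inter T K, Finset.union_comm]
  refine .union_of_isSplit (hA_split.mono hTK hTK') (hcut_split.mono hTK hTK')
    (Finset.disjoint_sdiff_inter T K).symm (Finset.mem_inter.mpr ⟨hxT, hxK⟩)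
    (Finset.mem_sdiff.mpr ⟨hkT, hkK⟩) (hA x k hxk) (hA k x hxk.symm) (hT _ ?_) (hT _ ?_)
  · exact (Finset.ssubset_iff_of_subset (by grind)).mpr ⟨i, hiT, by simp [hik, hiK]⟩
  · exact (Finset.ssubset_iff_of_subset (by grind)).mpr ⟨y, hyT, by simp [hxy'.symm, hyK]⟩

lemma pmeOn_cutMatrix (hA : IsDense A) (hS : QuartetDichotomy A S) (hi : i ∈ S) (hk : k ∉ S)
    (T : Finset V) : PMEOn A (cutMatrix A S i k) T := by
  induction T using Finset.strongInduction generalizing i k with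
  | H T ih =>
    by_cases hTS : T ⊆ S
    · exact .of_principal_eq <| principal_eq_principal_iff.mpr fun x hx y hy =>
        (cutMatrix_of_mem (hTS hx) (hTS hy)).symm
    by_cases hTS' : Disjoint T S
    · exact .of_principal_eq <| principal_eq_principal_iff.mpr fun x hx y hy =>
        (cutMatrix_of_notMem (Finset.disjoint_left.mp hTS' hx)
          (Finset.disjoint_left.mp hTS' hy)).symm
    obtain ⟨k₀, hk₀T, hk₀⟩ := Finset.not_subset.mp hTS
    obtain ⟨i₀, hi₀T, hi₀⟩ := Finset.not_disjoint_iff.mp hTS'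
    refine PMEOn.trans ?_ (pmeOn_cutMatrix_cutMatrix hA hS hi₀ hi hk₀ hk T)
    by_cases hadj : ∃ x ∈ T, ∃ y ∈ T, (crossGraph A S i₀ k₀).Adj x y
    · obtain ⟨x, hxT, y, hyT, hxy⟩ := hadj
      exact pmeOn_cutMatrix_of_crossGraph_adj hA hS hi₀ hk₀ hi₀T hk₀T hxT hyT hxy
        fun T' hT' => ih T' hT' hi₀ hk₀
    · exact .of_principal_eq <| principal_eq_principal_iff.mpr fun x hx y hy =>
        (cutMatrix_of_not_crossGraph_adj hA hi₀ hk₀ fun hxy => hadj ⟨x, hx, y, hy, hxy⟩).1.symm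

end CutMatrixPME

section Restriction

variable {V F : Type*} [DecidableEq V] [Field F] {A C : Matrix V V F} {S : Finset V}

lemma PME.restrict (h : PME C A) (T : Finset V) : PME (principal C T) (principal A T) := by
  intro S
  have hprincipal : ∀ M : Matrix V V F,
      (principal M (S.map (.subtype _))).det = (principal (principal M T) S).det := fun M =>
    det_principal_of_range M (f := fun s : S => ((s : T) : V))
      (Subtype.val_injective.comp Subtype.val_injective) (by ext; simp)
  rw [← hprincipal, ← hprincipal]
  exact h _

variable [Fintype V]

lemma IsCut.restrict (hC : IsCut C S) {T : Finset V} {Y : Finset T}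
    (hY : ∀ x : T, x ∈ Y ↔ (x : V) ∈ S) (hcard : 2 ≤ Y.card)
    (hcard' : Y.card + 2 ≤ Fintype.card T) : IsCut (principal C T) Y := by
  let f : Y → S := fun x => ⟨(x : T), (hY x).mp x.2⟩
  let g : (Yᶜ : Finset T) → (Sᶜ : Finset V) := fun x =>
    ⟨(x : T), Finset.mem_compl.mpr fun h => Finset.mem_compl.mp x.2 ((hY x).mpr h)⟩
  exact ⟨hcard, hcard', (rank_submatrix_le (block C S Sᶜ) f g).trans hC.2.2.1,
    (rank_submatrix_le (block C Sᶜ S) g f).trans hC.2.2.2⟩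

lemma IsCut.propertyP (hC : IsCut C S) (h : PME C A) {i j k l : V} (hi : i ∈ S) (hj : j ∈ S)
    (hk : k ∈ Sᶜ) (hl : l ∈ Sᶜ) (hij : i ≠ j) (hkl : k ≠ l) : PropertyP A i j k l := by
  rw [Finset.mem_compl] at hk hl
  have hpair : (({i, j} : Finset V).subtype fun v => v ∈ ({i, j, k, l} : Finset V)).card = 2 := by
    rw [Finset.card_subtype, Finset.filter_true_of_mem (by grind), Finset.card_pair hij]
  have hquadruple : ({i, j, k, l} : Finset V).card = 4 := by
    rw [Finset.card_insert_of_notMem (by grind), Finset.card_insert_of_notMem (by grind),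
      Finset.card_pair hkl]
  refine ⟨principal C _, h.restrict _, hC.restrict (fun x => ?_) hpair.ge ?_⟩
  · have := x.2
    rw [Finset.mem_subtype]
    grind
  · rw [hpair, Fintype.card_coe, hquadruple]

end Restriction

theorem lemma5p14_general {V F : Type*} [Fintype V] [DecidableEq V] [Field F] {A : Matrix V V F}
    (hA : IsDense A) (S : Finset V) :
    IsPlausible A S ↔ ∃ C : Matrix V V F, PME C A ∧ IsCut C S := by
  constructor
  · intro h
    obtain ⟨i, hi⟩ : S.Nonempty := Finset.card_pos.mp (by have := h.1; omega)
    obtain ⟨k, hk⟩ : Sᶜ.Nonempty :=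
      Finset.card_pos.mp (by have := h.2.1; rw [Finset.card_compl]; omega)
    have hpme := pmeOn_cutMatrix hA (h.quartetDichotomy hA) hi (Finset.mem_compl.mp hk) Finset.univ
    exact ⟨cutMatrix A S i k, fun T => hpme.symm T (Finset.subset_univ T),
      isCut_cutMatrix A i k h.1 h.2.1⟩
  · rintro ⟨C, hCA, hC⟩
    exact ⟨hC.1, hC.2.1, fun i hi j hj k hk l hl hij hkl =>
      hC.propertyP hCA hi hj hk hl hij hkl⟩

theorem lemma5p14 {F : Type*} [Field F] (n : ℕ) (A : Matrix (Fin n) (Fin n) F)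
    (hA : PropertyR A) (S : Finset (Fin n)) :
    IsPlausible A S ↔ ∃ C : Matrix (Fin n) (Fin n) F, PME C A ∧ IsCut C S := by
  exact lemma5p14_general hA.1 S
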